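/- Let $\mu>0$ and let $V\in L^{3/2}(\mathbb{R}^3)$ be real-valued with $V\le 0$ almost everywhere and $V$ not almost everywhere zero. For $T=1/\beta>0$ let $$K_{\beta,\mu}=(p^2-\mu)\,\frac{e^{\beta(p^2-\mu)}+1}{e^{\beta(p^2-\mu)}-1},\qquad p^2=-\Delta,$$ regarded as a multiplication operator in momentum space, and for $T=0$ ($\beta=\infty$) let $K_{\infty,\mu}=|p^2-\mu|$. For $W\in L^{3/2}(\mathbb{R}^3)$ real-valued, the critical temperature $T_c(W)$ is the least $T=1/\beta\ge 0$ such that $K_{\beta,\mu}+W\ge 0$ in the sense of quadratic forms on $H^1(\mathbb{R}^3)$, i.e. such that $$\langle\psi,K_{\beta,\mu}\psi\rangle+\int_{\mathbb{R}^3}W|\psi|^2\,dx\ \ge\ 0\qquad\text{for all }\psi\in H^1(\mathbb{R}^3);$$ thus $\inf\operatorname{spec}(K_{\beta,\mu}+W)<0$ for $0\le T<T_c(W)$. Then there exist a strictly increasing, strictly positive function $g_{\mu,V}:(0,\infty)\to(0,\infty)$ and a constant $b=b(\mu,V)>0$ such that $$\lim_{t\downarrow 0}\frac{g_{\mu,V}(t)}{e^{-b/t}}=1$$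 and the critical temperature for the potential $\lambda V$ satisfies $$T_c(\lambda V)\ \ge\ g_{\mu,V}(\lambda)\qquad\text{for all }\lambda>0.$$ -/

import Mathlib

open MeasureTheory Filter Asymptotics
open scoped ENNReal NNReal Topology FourierTransform

noncomputable section

namespace BCS

/-- Physical space (and momentum space) of dimension three. -/
abbrev Space : Type := EuclideanSpace ℝ (Fin 3)

/-- The one-variable function behind the BCS kinetic symbol: at temperature `T = 1/β > 0` and
energy `e = p² - μ` it is `e (exp (β e) + 1) / (exp (β e) - 1)`, extended by its limit `2 T` at
`e = 0`; at temperature zero it is `|e|`. -/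
def kineticSymbol (T e : ℝ) : ℝ :=
  if T = 0 then |e|
  else if e = 0 then 2 * T
  else e * (Real.exp (e / T) + 1) / (Real.exp (e / T) - 1)

/-- The quadratic form `⟨ψ, K_{β,μ} ψ⟩` of the multiplication operator
`K_{β,μ}` in momentum space. Mathlib's Fourier transform has kernel `exp (-2 π i ⟨x, ξ⟩)`,
so the momentum is `p = 2 π ξ`, and `-Δ` is multiplication by `p² = (2 π ‖ξ‖)²`. -/
def kineticForm (μ T : ℝ) (ψ : Lp ℂ 2 (volume : Measure Space)) : ℝ :=
  ∫ ξ : Space, kineticSymbol T ((2 * Real.pi * ‖ξ‖) ^ 2 - μ) *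
    ‖(𝓕 ψ : Lp ℂ 2 (volume : Measure Space)) ξ‖ ^ 2

/-- The quadratic form `∫ V |ψ|²` of the multiplication operator `V` in position space. -/
def potentialForm (V : Space → ℝ) (ψ : Lp ℂ 2 (volume : Measure Space)) : ℝ :=
  ∫ x : Space, V x * ‖ψ x‖ ^ 2

/-- `K_{β,μ} + V ≥ 0` at temperature `T = 1/β`, in the sense of quadratic forms on the form
domain `H¹(ℝ³)`. For `V ∈ L^{3/2}`, `V` is relatively form-bounded with respect to `-Δ`, and the
negation of this property says that the bottom of the spectrum of `K_{β,μ} + V` is negative. -/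
def IsNonnegAt (μ T : ℝ) (V : Space → ℝ) : Prop :=
  ∀ ψ : Lp ℂ 2 (volume : Measure Space),
    TemperedDistribution.MemSobolev 1 2 (Lp.toTemperedDistribution ψ) →
      0 ≤ kineticForm μ T ψ + potentialForm V ψ

/-- The critical temperature: the least temperature `T ≥ 0` with `K_{β,μ} + V ≥ 0`, `β = 1/T`,
as an element of `[0, ∞]`. Below it, the bottom of the spectrum of `K_{β,μ} + V` is negative. -/
def criticalTemperature (μ : ℝ) (V : Space → ℝ) : ℝ≥0∞ :=
  ⨅ (T : ℝ≥0) (_ : IsNonnegAt μ T V), (T : ℝ≥0∞)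

end BCS

end

/-! A single trial function shows that `K + λV` is not nonnegative. With `S = |p² - μ| + 2T'` and `T
≤ T'`, the kinetic symbol at temperature `T` is at most `S` (`kineticSymbol_le`). Take `ψ` with
Fourier transform `1_D / S` and put `L = ∫_D 1/S`. The kinetic form is then at most `L`. If `D` lies
in a small ball, the plane waves interfere constructively on `|x| < R`, so `|ψ| ≥ L/2` there, and
the potential form is at most `-λκL²` with `κ = ¼ ∫_{|x|<R} |V|`. Positivity fails once `λκL > 1`
(`not_isNonnegAt_of_trial`).

Over a shell at the Fermi sphere, `∫ 1/S` diverges like `c log(A/T')`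
(`exists_log_le_integral_fermiShell`). Finitely many small balls cover the shell, and one of them
carries its share of this mass. Hence positivity fails for all `T < A exp(-a/λ)`. Since no sharp `b`
is required, a larger exponent absorbs the constant `A`. -/

section Fourier

/-! ### Fourier inversion on `L¹ ∩ L²` and Sobolev regularity. -/

variable {E : Type*} [NormedAddCommGroup E] [InnerProductSpace ℝ E] [FiniteDimensional ℝ E]
  [MeasurableSpace E] [BorelSpace E]

/-- The inverse Fourier transform on `L²` is given by the Fourier integral on `L¹ ∩ L²`. -/
theorem coeFn_fourierInv_toLp_ae_eq {f : E → ℂ} (hf : Integrable f) (hf2 : MemLp f 2) :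
    ((𝓕⁻ (hf2.toLp f) : Lp ℂ 2 (volume : Measure E)) : E → ℂ) =ᵐ[volume] 𝓕⁻ f := by
  have hcont : Continuous (𝓕⁻ f) :=
    VectorFourier.fourierIntegral_continuous (L := -innerₗ E) Real.continuous_fourierChar
      (by change Continuous fun p : E × E => -inner ℝ p.1 p.2; fun_prop) hf
  -- Test both sides against smooth compactly supported functions; by duality `𝓕⁻` moves onto the
  -- test function.
  refine ae_eq_of_integral_contDiff_smul_eq
    ((Lp.memLp _).locallyIntegrable (by norm_num)) hcont.locallyIntegrable fun g hg hgc => ?_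
  have hg₁ : HasCompactSupport (Complex.ofRealCLM ∘ g) := hgc.comp_left rfl
  have hg₂ : ContDiff ℝ (⊤ : ℕ∞) (Complex.ofRealCLM ∘ g) := by fun_prop
  set G : SchwartzMap E ℂ := hg₁.toSchwartzMap hg₂ with hG
  have h1 : ∫ x, g x • (𝓕⁻ (hf2.toLp f) : Lp ℂ 2 (volume : Measure E)) x =
      Lp.toTemperedDistribution (𝓕⁻ (hf2.toLp f) : Lp ℂ 2 (volume : Measure E)) G := by
    simp [hG]
  have h2 : ∫ x, (𝓕⁻ G) x • (hf2.toLp f) x = ∫ x, (𝓕⁻ G) x • f x := by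
    apply integral_congr_ae
    filter_upwards [hf2.coeFn_toLp] with x hx
    rw [hx]
  have h3 : ∫ x, (𝓕⁻ (G : E → ℂ)) x • f x = ∫ x, G x • (𝓕⁻ f) x := by
    have := VectorFourier.integral_fourierIntegral_smul_eq_flip (μ := (volume : Measure E))
      (ν := (volume : Measure E)) (L := -innerₗ E)
      Real.continuous_fourierChar
      (by change Continuous fun p : E × E => -inner ℝ p.1 p.2; fun_prop) G.integrable hf
    have hflip : (-innerₗ E).flip = -innerₗ E := by
      ext x y; simp [real_inner_comm]
    rw [hflip] at this
    exact this
  rw [h1, ← Lp.fourierInv_toTemperedDistribution_eq, TemperedDistribution.fourierInv_apply,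
    Lp.toTemperedDistribution_apply, h2, SchwartzMap.fourierInv_coe, h3]
  simp [hG]

/-- The inverse Fourier transform of a function with enough decay lies in a Sobolev space. -/
theorem memSobolev_fourierInv_toLp {s : ℝ} {f : E → ℂ} (hf2 : MemLp f 2)
    (hs : MemLp (fun ξ => (((1 + ‖ξ‖ ^ 2) ^ (s / 2) : ℝ) : ℂ) * f ξ) 2) :
    TemperedDistribution.MemSobolev s 2
      (Lp.toTemperedDistribution (𝓕⁻ (hf2.toLp f) : Lp ℂ 2 (volume : Measure E))) := by
  rw [TemperedDistribution.memSobolev_iff_exists_smulLeftCLM_fourier]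
  refine ⟨hs.toLp _, ?_⟩
  rw [Lp.fourier_toTemperedDistribution_eq, FourierTransform.fourier_fourierInv_eq]
  ext u
  rw [TemperedDistribution.smulLeftCLM_apply_apply, Lp.toTemperedDistribution_apply,
    Lp.toTemperedDistribution_apply]
  apply integral_congr_ae
  filter_upwards [hf2.coeFn_toLp, hs.coeFn_toLp] with x hx hx'
  have hw : (fun x : E => (((1 + ‖x‖ ^ 2) ^ (s / 2) : ℝ) : ℂ)).HasTemperateGrowth := by fun_prop
  rw [hx, hx', SchwartzMap.smulLeftCLM_apply_apply hw]
  simp only [smul_eq_mul]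
  ring

end Fourier

/-! ### Bounds on the kinetic symbol and on the potential. -/

namespace BCS

theorem kineticSymbol_nonneg {T : ℝ} (hT : 0 ≤ T) (e : ℝ) : 0 ≤ kineticSymbol T e := by
  unfold kineticSymbol
  split_ifs with h0 he
  · exact abs_nonneg e
  · linarith
  · have hT' : 0 < T := lt_of_le_of_ne hT (Ne.symm h0)
    rcases lt_or_gt_of_ne he with h | h
    · have : Real.exp (e / T) < 1 := Real.exp_lt_one_iff.2 (div_neg_of_neg_of_pos h hT')
      apply div_nonneg_of_nonpos
      · exact mul_nonpos_of_nonpos_of_nonneg h.le (by positivity)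
      · linarith
    · have : 1 < Real.exp (e / T) := Real.one_lt_exp_iff.2 (div_pos h hT')
      apply div_nonneg
      · positivity
      · linarith

/-- For `T > 0` and `e ≠ 0` the symbol equals `|e| + 2|e| / (exp(|e|/T) - 1)`, and `exp x ≥ 1 + x`
bounds the last term by `2T`. -/
theorem kineticSymbol_le {T : ℝ} (hT : 0 ≤ T) (e : ℝ) : kineticSymbol T e ≤ |e| + 2 * T := by
  unfold kineticSymbol
  split_ifs with h0 he
  · linarith
  · simp [he]
  · have hT' : 0 < T := lt_of_le_of_ne hT (Ne.symm h0)
    rcases lt_or_gt_of_ne he with h | h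
    · have h1 : Real.exp (e / T) < 1 := Real.exp_lt_one_iff.2 (div_neg_of_neg_of_pos h hT')
      have h2 : -(e / T) + 1 ≤ Real.exp (-(e / T)) := Real.add_one_le_exp _
      have h3 : Real.exp (-(e / T)) * Real.exp (e / T) = 1 := by
        rw [← Real.exp_add]; simp
      have h4 : (-(e / T) + 1) * Real.exp (e / T) ≤ 1 := by
        exact (mul_le_mul_of_nonneg_right h2 (Real.exp_pos _).le).trans h3.le
      have h5 : T * ((-(e / T) + 1) * Real.exp (e / T)) ≤ T * 1 := by gcongr
      have h6 : T * ((-(e / T) + 1) * Real.exp (e / T)) = (-e + T) * Real.exp (e / T) := by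
        field_simp
      rw [abs_of_neg h, div_le_iff_of_neg (by linarith)]
      nlinarith
    · have h1 : e / T + 1 ≤ Real.exp (e / T) := Real.add_one_le_exp _
      have h2 : 0 < e / T := div_pos h hT'
      have h3 : T * (e / T) ≤ T * (Real.exp (e / T) - 1) := by gcongr; linarith
      rw [mul_div_cancel₀ _ h0] at h3
      rw [abs_of_pos h, div_le_iff₀ (by linarith)]
      nlinarith

/-- A potential in `L^{3/2}` is integrable against a bounded integrable density. -/
theorem integrable_mul_of_memLp {V w : Space → ℝ} (hV : MemLp V (3 / 2)) (hw : Integrable w)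
    {C : ℝ} (hC : ∀ᵐ x, ‖w x‖ ≤ C) : Integrable (fun x => V x * w x) := by
  have hV' : Integrable (fun x => ‖V x‖ ^ (3 / 2 : ℝ)) := by
    have := hV.integrable_norm_rpow (by norm_num) (by finiteness)
    simpa using this
  refine ((hw.norm.add (hV'.const_mul C))).mono' (hV.1.mul hw.1) ?_
  filter_upwards [hC] with x hx
  rw [norm_mul]
  simp only [Pi.add_apply]
  have hw0 := norm_nonneg (w x)
  -- Where `|V| ≤ 1` the product is dominated by `|w|`; elsewhere `|V| ≤ |V|^{3/2}` and `|w| ≤ C`.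
  rcases le_total ‖V x‖ 1 with h | h
  · have : 0 ≤ C * ‖V x‖ ^ (3 / 2 : ℝ) := mul_nonneg (hw0.trans hx) (by positivity)
    nlinarith
  · have h1 : ‖V x‖ ≤ ‖V x‖ ^ (3 / 2 : ℝ) := by
      simpa using Real.rpow_le_rpow_of_exponent_le h (by norm_num : (1 : ℝ) ≤ 3 / 2)
    have h2 : ‖V x‖ * ‖w x‖ ≤ ‖V x‖ ^ (3 / 2 : ℝ) * C := by gcongr
    linarith

/-- A potential that does not vanish identically has nonzero mass on some ball. -/
theorem exists_ball_integral_neg {V : Space → ℝ} (hV : MemLp V (3 / 2))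
    (hVneg : ∀ᵐ x, V x ≤ 0) (hVne : ¬ V =ᵐ[volume] 0) :
    ∃ R : ℝ, 0 < R ∧ IntegrableOn V (Metric.ball 0 R) ∧
      0 < ∫ x in Metric.ball (0 : Space) R, -V x := by
  have hint : ∀ R : ℝ, IntegrableOn V (Metric.ball 0 R) := fun R => by
    have hw : Integrable ((Metric.ball (0 : Space) R).indicator fun _ => (1 : ℝ)) :=
      (integrable_indicator_iff measurableSet_ball).2
        (integrableOn_const measure_ball_lt_top.ne)
    have := integrable_mul_of_memLp hV hw (C := 1) (ae_of_all _ fun x =>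
      (norm_indicator_le_norm_self _ _).trans (by simp))
    rw [← integrable_indicator_iff measurableSet_ball]
    refine this.congr (ae_of_all _ fun x => ?_)
    by_cases hx : x ∈ Metric.ball (0 : Space) R <;> simp [hx]
  by_contra! hcon
  apply hVne
  -- If every ball had zero mass, the sign of `V` would force `V = 0` almost everywhere on each
  -- ball; radii `n + 1` are positive and exhaust space.
  have hball : ∀ n : ℕ, ∀ᵐ x, x ∈ Metric.ball (0 : Space) (n + 1) → V x = 0 := fun n => by
    have h0 : ∀ᵐ x ∂(volume.restrict (Metric.ball (0 : Space) (n + 1))), 0 ≤ -V x :=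
      ae_restrict_of_ae (hVneg.mono fun x hx => by linarith)
    have h1 := le_antisymm (hcon (n + 1) (by positivity) (hint _)) (integral_nonneg_of_ae h0)
    rw [integral_eq_zero_iff_of_nonneg_ae h0 (hint _).neg,
      EventuallyEq, ae_restrict_iff' measurableSet_ball] at h1
    filter_upwards [h1] with x hx hxb
    simpa using hx hxb
  filter_upwards [ae_all_iff.2 hball] with x hx
  obtain ⟨n, hn⟩ := exists_nat_gt ‖x‖
  exact hx n (by simp; linarith)

end BCS

/-! ### The trial function and the variational estimate. -/

namespace BCS

/-- The denominator `|p² - μ| + 2 T` of the trial function, at momentum `p = 2 π ξ`. -/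
noncomputable def shiftedSymbol (μ T : ℝ) (ξ : Space) : ℝ :=
  |(2 * Real.pi * ‖ξ‖) ^ 2 - μ| + 2 * T

theorem two_mul_le_shiftedSymbol (μ T : ℝ) (ξ : Space) : 2 * T ≤ shiftedSymbol μ T ξ := by
  simp [shiftedSymbol]

theorem shiftedSymbol_pos (μ : ℝ) {T : ℝ} (hT : 0 < T) (ξ : Space) : 0 < shiftedSymbol μ T ξ :=
  (by positivity : 0 < 2 * T).trans_le (two_mul_le_shiftedSymbol μ T ξ)

theorem continuous_inv_shiftedSymbol (μ : ℝ) {T : ℝ} (hT : 0 < T) :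
    Continuous fun ξ => (shiftedSymbol μ T ξ)⁻¹ := by
  refine Continuous.inv₀ ?_ fun ξ => (shiftedSymbol_pos μ hT ξ).ne'
  unfold shiftedSymbol
  fun_prop

theorem integrableOn_inv_shiftedSymbol (μ : ℝ) {T : ℝ} (hT : 0 < T) {D : Set Space} {M : ℝ}
    (hDM : D ⊆ Metric.closedBall 0 M) : IntegrableOn (fun ξ => (shiftedSymbol μ T ξ)⁻¹) D :=
  ((continuous_inv_shiftedSymbol μ hT).continuousOn.integrableOn_compact
    (isCompact_closedBall 0 M)).mono_set hDM

/-- A continuous function cut off to a bounded measurable set is in every `L^p`. -/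
theorem memLp_indicator_of_continuous {D : Set Space} {M : ℝ} (hD : MeasurableSet D)
    (hDM : D ⊆ Metric.closedBall 0 M) {h : Space → ℂ} (hh : Continuous h) (p : ℝ≥0∞) :
    MemLp (D.indicator h) p := by
  rw [memLp_indicator_iff_restrict hD]
  have hfin : volume D < ⊤ := (measure_mono hDM).trans_lt measure_closedBall_lt_top
  have : IsFiniteMeasure (volume.restrict D) := ⟨by simpa using hfin⟩
  obtain ⟨C, hC⟩ := (isCompact_closedBall (0 : Space) M).exists_bound_of_continuousOn
    hh.continuousOn
  exact MemLp.of_bound hh.aestronglyMeasurable C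
    ((ae_restrict_iff' hD).2 (ae_of_all _ fun x hx => hC x (hDM hx)))

/-- If the phases `exp (2 π i ⟨ξ, x⟩)` stay close to each other for `ξ ∈ D`, the inverse Fourier
integral of a nonnegative function supported on `D` is at least half its total mass. -/
theorem half_integral_le_norm_fourierInv {D : Set Space} (hD : MeasurableSet D) {h : Space → ℝ}
    (hh : IntegrableOn h D) (h0 : ∀ ξ, 0 ≤ h ξ) (ξ₀ x : Space)
    (hcos : ∀ ξ ∈ D, 1 / 2 ≤ Real.cos (2 * Real.pi * inner ℝ (ξ - ξ₀) x)) :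
    (∫ ξ in D, h ξ) / 2 ≤ ‖𝓕⁻ (D.indicator fun ξ => (h ξ : ℂ)) x‖ := by
  have hhC : IntegrableOn (fun ξ => (h ξ : ℂ)) D := hh.ofReal
  -- Multiplying by `ω` removes the phase at the centre `ξ₀`; the real part of the rotated integrand
  -- is then at least `h / 2` on `D`.
  set ω : ℂ := Complex.exp (((-(2 * Real.pi * inner ℝ ξ₀ x) : ℝ) : ℂ) * Complex.I) with hω
  have hωn : ‖ω‖ = 1 := Complex.norm_exp_ofReal_mul_I _
  have hmeas : AEStronglyMeasurable (fun ξ : Space =>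
      Complex.exp (((2 * Real.pi * inner ℝ (ξ - ξ₀) x : ℝ) : ℂ) * Complex.I)) :=
    (by fun_prop : Continuous (fun ξ : Space =>
      Complex.exp (((2 * Real.pi * inner ℝ (ξ - ξ₀) x : ℝ) : ℂ) * Complex.I))).aestronglyMeasurable
  have hint : IntegrableOn (fun ξ : Space =>
      Complex.exp (((2 * Real.pi * inner ℝ (ξ - ξ₀) x : ℝ) : ℂ) * Complex.I) * (h ξ : ℂ)) D := by
    refine hhC.norm.mono' (hmeas.restrict.mul hhC.1) (ae_of_all _ fun ξ => ?_)
    rw [norm_mul, Complex.norm_exp_ofReal_mul_I, one_mul]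
  have hrot : ω * 𝓕⁻ (D.indicator fun ξ => (h ξ : ℂ)) x = ∫ ξ in D,
      Complex.exp (((2 * Real.pi * inner ℝ (ξ - ξ₀) x : ℝ) : ℂ) * Complex.I) * (h ξ : ℂ) := by
    rw [Real.fourierInv_eq', ← integral_const_mul, ← integral_indicator hD]
    refine integral_congr_ae (ae_of_all _ fun ξ => ?_)
    by_cases hξ : ξ ∈ D
    · simp only [Set.indicator_of_mem hξ, smul_eq_mul]
      rw [← mul_assoc, hω, ← Complex.exp_add, inner_sub_left]
      congr 2
      push_cast
      ring
    · simp [hξ]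
  rw [← one_mul ‖𝓕⁻ (D.indicator fun ξ => (h ξ : ℂ)) x‖, ← hωn, ← norm_mul, hrot]
  refine le_trans ?_ (Complex.re_le_norm _)
  rw [← RCLike.re_to_complex, ← integral_re hint, ← integral_div]
  refine setIntegral_mono_on (hh.div_const 2) hint.re hD fun ξ hξ => ?_
  rw [RCLike.re_to_complex, Complex.re_mul_ofReal, Complex.exp_ofReal_mul_I_re]
  nlinarith [hcos ξ hξ, h0 ξ]

/-- The variational argument: a trial function concentrated in momentum space on `D` destroys
positivity as soon as the mass of `1 / (|p² - μ| + 2 T')` on `D` is large enough. -/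
theorem not_isNonnegAt_of_trial {μ T T' l R M : ℝ} {V : Space → ℝ} (hT : 0 ≤ T) (hTT' : T ≤ T')
    (hT' : 0 < T') (hl : 0 < l) (hV : MemLp V (3 / 2)) (hVneg : ∀ᵐ x, V x ≤ 0)
    (hVR : IntegrableOn V (Metric.ball 0 R)) {D : Set Space} (hD : MeasurableSet D)
    (hDM : D ⊆ Metric.closedBall 0 M) (ξ₀ : Space)
    (hcos : ∀ x ∈ Metric.ball (0 : Space) R, ∀ ξ ∈ D,
      1 / 2 ≤ Real.cos (2 * Real.pi * inner ℝ (ξ - ξ₀) x))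
    (hL0 : 0 < ∫ ξ in D, (shiftedSymbol μ T' ξ)⁻¹)
    (hL : 1 < l * ((∫ x in Metric.ball (0 : Space) R, -V x) / 4) *
      ∫ ξ in D, (shiftedSymbol μ T' ξ)⁻¹) :
    ¬ IsNonnegAt μ T fun x => l * V x := by
  intro hnn
  set w : Space → ℝ := fun ξ => (shiftedSymbol μ T' ξ)⁻¹ with hw
  have hwc : Continuous w := continuous_inv_shiftedSymbol μ hT'
  have hw0 : ∀ ξ, 0 ≤ w ξ := fun ξ => (inv_pos.2 (shiftedSymbol_pos μ hT' ξ)).le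
  have hwi : IntegrableOn w D := integrableOn_inv_shiftedSymbol μ hT' hDM
  set L : ℝ := ∫ ξ in D, w ξ with hLdef
  set f : Space → ℂ := D.indicator fun ξ => (w ξ : ℂ) with hf
  have hwcC : Continuous fun ξ => (w ξ : ℂ) := Complex.continuous_ofReal.comp hwc
  have hf1 : Integrable f := memLp_one_iff_integrable.1 (memLp_indicator_of_continuous hD hDM hwcC 1)
  have hf2 : MemLp f 2 := memLp_indicator_of_continuous hD hDM hwcC 2
  set ψ : Lp ℂ 2 (volume : Measure Space) := 𝓕⁻ (hf2.toLp f) with hψ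
  have hψae : (ψ : Space → ℂ) =ᵐ[volume] 𝓕⁻ f := coeFn_fourierInv_toLp_ae_eq hf1 hf2
  have hsob : TemperedDistribution.MemSobolev 1 2 (Lp.toTemperedDistribution ψ) := by
    refine memSobolev_fourierInv_toLp hf2 ?_
    have hc : Continuous fun ξ : Space => (((1 + ‖ξ‖ ^ 2) ^ ((1 : ℝ) / 2) : ℝ) : ℂ) * (w ξ : ℂ) := by
      refine (Complex.continuous_ofReal.comp ?_).mul hwcC
      exact Continuous.rpow_const (by fun_prop) fun ξ => Or.inr (by norm_num)
    convert memLp_indicator_of_continuous hD hDM hc 2 using 2 with ξ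
    by_cases hξ : ξ ∈ D <;> simp [hf, hξ]
  -- The symbol is at most `1 / w`, so the symbol times `w²` is at most `w`.
  have hkin : kineticForm μ T ψ ≤ L := by
    unfold kineticForm
    rw [hψ, FourierTransform.fourier_fourierInv_eq, hLdef, ← integral_indicator hD]
    refine integral_mono_of_nonneg
      (ae_of_all _ fun ξ => mul_nonneg (kineticSymbol_nonneg hT _) (by positivity))
      ((integrable_indicator_iff hD).2 hwi) ?_
    filter_upwards [hf2.coeFn_toLp] with ξ hξ
    rw [hξ]
    by_cases hξD : ξ ∈ D
    · have hpos := shiftedSymbol_pos μ hT' ξ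
      have h1 : kineticSymbol T ((2 * Real.pi * ‖ξ‖) ^ 2 - μ) ≤ shiftedSymbol μ T' ξ :=
        (kineticSymbol_le hT _).trans (by unfold shiftedSymbol; linarith)
      simp only [hf, Set.indicator_of_mem hξD, Complex.norm_real, Real.norm_eq_abs, sq_abs]
      calc _ ≤ shiftedSymbol μ T' ξ * w ξ ^ 2 := by gcongr
        _ = w ξ := by simp only [hw]; field_simp
    · simp [hf, hξD]
  have hψ2 : Integrable fun x => ‖ψ x‖ ^ 2 := (Lp.memLp ψ).integrable_norm_pow (by norm_num)
  -- `ψ` is bounded because its Fourier transform is integrable; this makes `V |ψ|²` integrable.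
  have hψb : ∀ᵐ x, ‖‖ψ x‖ ^ 2‖ ≤ (∫ ξ, ‖f ξ‖) ^ 2 := by
    filter_upwards [hψae] with x hx
    rw [hx, norm_pow, norm_norm]
    gcongr
    exact VectorFourier.norm_fourierIntegral_le_integral_norm _ _ _ _ _
  have hVψ : Integrable fun x => V x * ‖ψ x‖ ^ 2 := integrable_mul_of_memLp hV hψ2 hψb
  have hpot : potentialForm (fun x => l * V x) ψ ≤
      -(l * ((∫ x in Metric.ball (0 : Space) R, -V x) / 4) * L ^ 2) := by
    have h1 : ∫ x, V x * ‖ψ x‖ ^ 2 ≤ ∫ x in Metric.ball (0 : Space) R, V x * ‖ψ x‖ ^ 2 := by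
      rw [← integral_indicator measurableSet_ball]
      refine integral_mono_ae hVψ (hVψ.indicator measurableSet_ball) ?_
      filter_upwards [hVneg] with x hx
      by_cases hxb : x ∈ Metric.ball (0 : Space) R
      · simp [hxb]
      · simp only [Set.indicator_of_notMem hxb]
        exact mul_nonpos_of_nonpos_of_nonneg hx (by positivity)
    have h2 : ∫ x in Metric.ball (0 : Space) R, V x * ‖ψ x‖ ^ 2 ≤
        ∫ x in Metric.ball (0 : Space) R, V x * (L / 2) ^ 2 := by
      refine integral_mono_ae hVψ.integrableOn (hVR.mul_const _) ?_
      filter_upwards [ae_restrict_of_ae hVneg, ae_restrict_of_ae hψae,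
        ae_restrict_mem measurableSet_ball] with x hx hx' hxb
      refine mul_le_mul_of_nonpos_left ?_ hx
      rw [hx']
      gcongr
      exact half_integral_le_norm_fourierInv hD hwi hw0 ξ₀ x (hcos x hxb)
    have h3 : potentialForm (fun x => l * V x) ψ = l * ∫ x, V x * ‖ψ x‖ ^ 2 := by
      unfold potentialForm
      rw [← integral_const_mul]
      simp only [mul_assoc]
    rw [integral_mul_const] at h2
    rw [h3, integral_neg]
    nlinarith [mul_le_mul_of_nonneg_left (h1.trans h2) hl.le]
  -- The total form is at most `L (1 - lκL)`, which is negative, where `κ` is a quarter of the mass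
  -- of `-V` on the ball.
  have := hnn ψ hsob
  nlinarith

end BCS

/-! ### Logarithmic divergence at the Fermi sphere and the exponential threshold. -/

namespace BCS

/-- The momentum shell of width one just outside the Fermi sphere `|2 π ξ| = √μ`. -/
def fermiShell (μ : ℝ) : Set Space :=
  {ξ | ‖ξ‖ ∈ Set.Ioo (√μ / (2 * Real.pi)) (√μ / (2 * Real.pi) + 1)}

theorem measurableSet_fermiShell (μ : ℝ) : MeasurableSet (fermiShell μ) :=
  measurable_norm measurableSet_Ioo

theorem fermiShell_subset (μ : ℝ) :
    fermiShell μ ⊆ Metric.closedBall 0 (√μ / (2 * Real.pi) + 1) := fun ξ hξ => by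
  simpa using hξ.2.le

/-- `∫₀¹ ds / (A s + 2 T) ≥ A⁻¹ log (A / (2 T))`. -/
theorem log_le_integral_inv {A T r : ℝ} (hA : 0 < A) (hT : 0 < T) :
    Real.log (A / (2 * T)) / A ≤ ∫ y in Set.Ioo r (r + 1), (A * (y - r) + 2 * T)⁻¹ := by
  rw [← integral_Ioc_eq_integral_Ioo, ← intervalIntegral.integral_of_le (by linarith)]
  have hd : ∀ y ∈ Set.uIcc r (r + 1), HasDerivAt
      (fun y => Real.log (A * (y - r) + 2 * T) / A) ((A * (y - r) + 2 * T)⁻¹) y := fun y hy => by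
    rw [Set.uIcc_of_le (by linarith)] at hy
    have hpos : 0 < A * (y - r) + 2 * T := by nlinarith [hy.1]
    have h1 : HasDerivAt (fun y => A * (y - r) + 2 * T) A y := by
      simpa using (((hasDerivAt_id y).sub_const r).const_mul A).add_const (2 * T)
    exact ((h1.log hpos.ne').div_const A).congr_deriv (by field_simp)
  have hc : ContinuousOn (fun y => (A * (y - r) + 2 * T)⁻¹) (Set.uIcc r (r + 1)) := by
    rw [Set.uIcc_of_le (by linarith)]
    refine ContinuousOn.inv₀ (by fun_prop) fun y hy => ?_
    have : 0 < A * (y - r) + 2 * T := by nlinarith [hy.1]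
    exact this.ne'
  rw [intervalIntegral.integral_eq_sub_of_hasDerivAt hd hc.intervalIntegrable, ← sub_div]
  simp only [add_sub_cancel_left, mul_one, sub_self, mul_zero, zero_add]
  rw [← Real.log_div (by positivity) (by positivity)]
  gcongr
  linarith

/-- The logarithmic divergence at the Fermi sphere, as the temperature goes to zero. -/
theorem exists_log_le_integral_fermiShell {μ : ℝ} (hμ : 0 < μ) :
    ∃ c A : ℝ, 0 < c ∧ 0 < A ∧ ∀ T : ℝ, 0 < T →
      c * Real.log (A / T) ≤ ∫ ξ in fermiShell μ, (shiftedSymbol μ T ξ)⁻¹ := by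
  set r : ℝ := √μ / (2 * Real.pi) with hr
  have hr0 : 0 < r := by positivity
  have hrμ : (2 * Real.pi * r) ^ 2 = μ := by
    rw [hr, mul_div_cancel₀ _ (by positivity), Real.sq_sqrt hμ.le]
  -- A Lipschitz constant: `(2πy)² - μ = (2π)² (y + r)(y - r)`, and `y + r ≤ 2r + 1` on the shell.
  set A : ℝ := (2 * Real.pi) ^ 2 * (2 * r + 1) with hA
  have hA0 : 0 < A := by positivity
  set v : ℝ := (volume : Measure Space).real (Metric.ball 0 1) with hv
  have hv0 : 0 < v := by
    rw [hv, Measure.real, ENNReal.toReal_pos_iff]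
    exact ⟨Metric.measure_ball_pos _ _ one_pos, measure_ball_lt_top⟩
  -- `3v` is the area of the unit sphere, `r²` bounds the radial weight `y²` from below, and the
  -- halved `A` comes from the shift `2T`.
  refine ⟨3 * v * r ^ 2 / A, A / 2, by positivity, by positivity, fun T hT => ?_⟩
  set k : ℝ → ℝ := (Set.Ioo r (r + 1)).indicator
    fun y => (|(2 * Real.pi * y) ^ 2 - μ| + 2 * T)⁻¹ with hk
  have hrad : ∫ ξ in fermiShell μ, (shiftedSymbol μ T ξ)⁻¹ = ∫ ξ : Space, k ‖ξ‖ := by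
    rw [← integral_indicator (measurableSet_fermiShell μ)]
    rfl
  have hpol : ∫ ξ : Space, k ‖ξ‖ = 3 * v * ∫ y in Set.Ioo r (r + 1),
      y ^ 2 * (|(2 * Real.pi * y) ^ 2 - μ| + 2 * T)⁻¹ := by
    rw [integral_fun_norm_addHaar, finrank_euclideanSpace_fin, ← hv]
    simp only [nsmul_eq_mul, smul_eq_mul, Nat.cast_ofNat, Nat.add_one_sub_one]
    rw [mul_assoc]
    congr 2
    have hsub : Set.Ioo r (r + 1) ⊆ Set.Ioi 0 := fun y hy => hr0.trans hy.1
    rw [← integral_indicator measurableSet_Ioo, ← integral_indicator measurableSet_Ioi]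
    refine integral_congr_ae (ae_of_all _ fun y => ?_)
    by_cases hy : y ∈ Set.Ioo r (r + 1)
    · have hy' : y ∈ Set.Ioi (0 : ℝ) := hsub hy
      simp only [hk, Set.indicator_of_mem hy, Set.indicator_of_mem hy']
    · simp [hk, hy]
  have hcmp : r ^ 2 * ∫ y in Set.Ioo r (r + 1), (A * (y - r) + 2 * T)⁻¹ ≤
      ∫ y in Set.Ioo r (r + 1), y ^ 2 * (|(2 * Real.pi * y) ^ 2 - μ| + 2 * T)⁻¹ := by
    rw [← integral_const_mul]
    refine setIntegral_mono_on ?_ ?_ measurableSet_Ioo fun y hy => ?_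
    · refine (ContinuousOn.integrableOn_Icc ?_).mono_set Set.Ioo_subset_Icc_self
      refine continuousOn_const.mul (ContinuousOn.inv₀ (by fun_prop) fun y hy => ?_)
      have : 0 < A * (y - r) + 2 * T := by nlinarith [hy.1]
      exact this.ne'
    · refine (ContinuousOn.integrableOn_Icc ?_).mono_set Set.Ioo_subset_Icc_self
      refine ContinuousOn.mul (by fun_prop) (ContinuousOn.inv₀ (by fun_prop) fun y hy => ?_)
      positivity
    · have he : (2 * Real.pi * y) ^ 2 - μ = (2 * Real.pi) ^ 2 * (y + r) * (y - r) := by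
        rw [← hrμ]; ring
      have hyr : 0 ≤ y - r := sub_nonneg.2 hy.1.le
      have hy1 : y ≤ r + 1 := hy.2.le
      have hry : r ≤ y := hy.1.le
      have hy0 : 0 < y := hr0.trans hy.1
      have habs : |(2 * Real.pi * y) ^ 2 - μ| ≤ A * (y - r) := by
        rw [he, abs_of_nonneg (by positivity), hA]
        refine mul_le_mul_of_nonneg_right (mul_le_mul_of_nonneg_left ?_ (by positivity)) hyr
        linarith
      gcongr
  rw [hrad, hpol]
  calc 3 * v * r ^ 2 / A * Real.log (A / 2 / T)
      = 3 * v * (r ^ 2 * (Real.log (A / (2 * T)) / A)) := by rw [div_div A 2 T]; ring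
    _ ≤ _ := by
      refine mul_le_mul_of_nonneg_left (le_trans ?_ hcmp) (by positivity)
      gcongr
      exact log_le_integral_inv hA0 hT

/-- Positivity fails below an exponentially small temperature, uniformly in the coupling. -/
theorem exists_not_isNonnegAt {μ : ℝ} (hμ : 0 < μ) {V : Space → ℝ} (hV : MemLp V (3 / 2))
    (hVneg : ∀ᵐ x, V x ≤ 0) (hVne : ¬ V =ᵐ[volume] 0) :
    ∃ a A : ℝ, 0 ≤ a ∧ 0 < A ∧ ∀ l T : ℝ, 0 < l → 0 ≤ T → T < A * Real.exp (-a / l) →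
      ¬ IsNonnegAt μ T fun x => l * V x := by
  obtain ⟨R, hR, hVR, hκ⟩ := exists_ball_integral_neg hV hVneg hVne
  obtain ⟨c, A, hc, hA, hlog⟩ := exists_log_le_integral_fermiShell hμ
  set κ : ℝ := (∫ x in Metric.ball (0 : Space) R, -V x) / 4 with hκdef
  have hκ0 : 0 < κ := by positivity
  set M : ℝ := √μ / (2 * Real.pi) + 1
  -- For `|ξ - p| ≤ ε` and `|x| ≤ R` the phase is at most 1 in absolute value, and `cos θ ≥ 1 - θ²/2
  -- ≥ 1/2`.
  set ε : ℝ := 1 / (2 * Real.pi * R) with hε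
  have hε0 : 0 < ε := by positivity
  obtain ⟨t, -, htfin, htcov⟩ := (isCompact_closedBall (0 : Space) M).finite_cover_balls hε0
  lift t to Finset Space using htfin
  -- This `a` makes `c log(A/T) > t.card / (lκ)` equivalent to `T < A exp(-a/l)` for `T > 0`.
  refine ⟨t.card / (κ * c), A, by positivity, hA, fun l T hl hT hTA => ?_⟩
  -- Regularizing with `T' > T` keeps the denominator positive and so includes `T = 0`.
  obtain ⟨T', hTT', hT'A⟩ := exists_between hTA
  have hT' : 0 < T' := hT.trans_lt hTT'
  set D : Space → Set Space := fun p => fermiShell μ ∩ Metric.ball p ε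
  have hDmeas : ∀ p, MeasurableSet (D p) := fun p =>
    (measurableSet_fermiShell μ).inter measurableSet_ball
  have hDM : ∀ p, D p ⊆ Metric.closedBall 0 M := fun p =>
    Set.inter_subset_left.trans (fermiShell_subset μ)
  set w : Space → ℝ := fun ξ => (shiftedSymbol μ T' ξ)⁻¹
  have hw0 : ∀ ξ, 0 ≤ w ξ := fun ξ => (inv_pos.2 (shiftedSymbol_pos μ hT' ξ)).le
  have hwi : ∀ p, IntegrableOn w (D p) := fun p => integrableOn_inv_shiftedSymbol μ hT' (hDM p)
  have htot : ∫ ξ in fermiShell μ, w ξ ≤ ∑ p ∈ t, ∫ ξ in D p, w ξ := by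
    rw [← integral_indicator (measurableSet_fermiShell μ)]
    simp_rw [← integral_indicator (hDmeas _)]
    rw [← integral_finsetSum _ fun p _ => (integrable_indicator_iff (hDmeas p)).2 (hwi p)]
    refine integral_mono ((integrable_indicator_iff (measurableSet_fermiShell μ)).2
      (integrableOn_inv_shiftedSymbol μ hT' (fermiShell_subset μ)))
      (integrable_finsetSum _ fun p _ => (integrable_indicator_iff (hDmeas p)).2 (hwi p))
      fun ξ => ?_
    have hnn : ∀ p ∈ t, 0 ≤ (D p).indicator w ξ := fun p _ =>
      Set.indicator_nonneg (fun ξ _ => hw0 ξ) ξ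
    by_cases hξ : ξ ∈ fermiShell μ
    · obtain ⟨p, hp, hξp⟩ := Set.mem_iUnion₂.1 (htcov (fermiShell_subset μ hξ))
      have hξD : ξ ∈ D p := ⟨hξ, hξp⟩
      calc (fermiShell μ).indicator w ξ = (D p).indicator w ξ := by
            rw [Set.indicator_of_mem hξ, Set.indicator_of_mem hξD]
        _ ≤ _ := Finset.single_le_sum hnn hp
    · rw [Set.indicator_of_notMem hξ]
      exact Finset.sum_nonneg hnn
  have hbig : t.card / (l * κ) < ∫ ξ in fermiShell μ, w ξ := by
    refine lt_of_lt_of_le ?_ (hlog T' hT')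
    have h1 : Real.exp (t.card / (κ * c) / l) < A / T' := by
      rw [lt_div_iff₀ hT']
      rw [neg_div, Real.exp_neg, ← div_eq_mul_inv, lt_div_iff₀ (Real.exp_pos _)] at hT'A
      linarith
    have h2 := (Real.lt_log_iff_exp_lt (by positivity)).2 h1
    calc (t.card : ℝ) / (l * κ) = c * (t.card / (κ * c) / l) := by field_simp
      _ < _ := by gcongr
  -- Pigeonhole: `t.card` pieces cannot all have mass at most `1 / (lκ)`.
  obtain ⟨p, -, hLp⟩ : ∃ p ∈ t, 1 / (l * κ) < ∫ ξ in D p, w ξ := by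
    by_contra! hcon
    have := Finset.sum_le_card_nsmul t _ _ hcon
    rw [nsmul_eq_mul, mul_one_div] at this
    linarith
  have hLp0 : 0 < ∫ ξ in D p, w ξ := lt_trans (by positivity) hLp
  refine not_isNonnegAt_of_trial hT hTT'.le hT' hl hV hVneg hVR (hDmeas p) (hDM p) p ?_ hLp0 ?_
  · intro x hx ξ hξ
    have hx' : ‖x‖ ≤ R := by simpa using (Metric.mem_ball.1 hx).le
    have hξ' : ‖ξ - p‖ ≤ ε := by simpa [dist_eq_norm] using (Metric.mem_ball.1 hξ.2).le
    have h1 : |2 * Real.pi * inner ℝ (ξ - p) x| ≤ 1 := by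
      rw [abs_mul, abs_of_pos (by positivity)]
      calc 2 * Real.pi * |inner ℝ (ξ - p) x| ≤ 2 * Real.pi * (ε * R) := by
            gcongr
            exact (abs_real_inner_le_norm _ _).trans (by gcongr)
        _ = 1 := by rw [hε]; field_simp
    have h2 := Real.one_sub_sq_div_two_le_cos (x := 2 * Real.pi * inner ℝ (ξ - p) x)
    have h3 := (sq_le_one_iff_abs_le_one _).2 h1
    linarith
  · rw [div_lt_iff₀ (by positivity)] at hLp
    change 1 < l * κ * ∫ ξ in D p, w ξ
    linarith

end BCS

theorem mainTheorem6 (μ : ℝ) (hμ : 0 < μ) (V : BCS.Space → ℝ)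
    (hV : MemLp V (3 / 2) (volume : Measure BCS.Space))
    (hVneg : ∀ᵐ x ∂(volume : Measure BCS.Space), V x ≤ 0)
    (hVne : ¬ (V =ᵐ[(volume : Measure BCS.Space)] 0)) :
    ∃ g : ℝ → ℝ,
      StrictMonoOn g (Set.Ioi 0) ∧
      (∀ t : ℝ, 0 < t → 0 < g t) ∧
      (∃ b : ℝ, 0 < b ∧ g ~[𝓝[>] 0] (fun t : ℝ => Real.exp (-b / t))) ∧
      ∀ l : ℝ, 0 < l →
        ENNReal.ofReal (g l) ≤ BCS.criticalTemperature μ (fun x => l * V x) := by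
  obtain ⟨a, A, ha, hA, hT⟩ := BCS.exists_not_isNonnegAt hμ hV hVneg hVne
  have hmono : ∀ b : ℝ, 0 < b → ∀ s t : ℝ, 0 < s → s < t →
      Real.exp (-b / s) < Real.exp (-b / t) := fun b hb s t hs hst => by
    rw [Real.exp_lt_exp, neg_div, neg_div, neg_lt_neg_iff]
    exact div_lt_div_of_pos_left hb hs hst
  -- The second entry keeps `g` below the threshold `A exp(-a/t)` for every `t`. The first, smaller
  -- by a factor `exp(-1/t)` up to `A`, is the minimum near zero and gives the asymptotics with
  -- constant 1. As `a` may vanish, adding 1 and 2 also makes both entries strictly increasing.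
  refine ⟨fun t => min (Real.exp (-(a + 2) / t)) (A * Real.exp (-(a + 1) / t)), ?_, ?_,
    ⟨a + 2, by linarith, ?_⟩, ?_⟩
  · intro s hs t _ hst
    exact min_lt_min (hmono _ (by linarith) s t hs hst)
      (mul_lt_mul_of_pos_left (hmono _ (by linarith) s t hs hst) hA)
  · intro t _
    positivity
  · refine IsEquivalent.congr_left IsEquivalent.refl ?_
    have hlim : Tendsto (fun t : ℝ => Real.exp (-t⁻¹)) (𝓝[>] 0) (𝓝 0) :=
      Real.tendsto_exp_neg_atTop_nhds_zero.comp tendsto_inv_nhdsGT_zero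
    filter_upwards [hlim.eventually_lt_const hA, self_mem_nhdsWithin] with t ht ht0
    have ht0' : (0 : ℝ) < t := ht0
    refine (min_eq_left ?_).symm
    calc Real.exp (-(a + 2) / t) = Real.exp (-t⁻¹) * Real.exp (-(a + 1) / t) := by
          rw [← Real.exp_add]; congr 1; field_simp; ring
      _ ≤ _ := by gcongr
  · intro l hl
    refine le_iInf₂ fun T hTnn => ?_
    by_contra! hlt
    rw [ENNReal.lt_ofReal_iff_toReal_lt ENNReal.coe_ne_top, ENNReal.coe_toReal] at hlt
    refine hT l T hl T.2 (hlt.trans_le ((min_le_right _ _).trans ?_)) hTnn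
    gcongr
    linarith
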